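/- **Conventions.** Identify $\mathbb R^2$ with $\mathbb C$. A *circle* here means a circle of positive radius or a line. It is taken together with the closed disc, respectively one of the closed half-planes, that it bounds; circles are *externally tangent* if these closed regions touch at a point of the plane and have disjoint interiors (two lines are never externally tangent). Let $C_0$ be a circle of positive radius with center $c_0$, and let $C_1,C_2$ be circles, at most one of them a line, such that $C_0,C_1,C_2$ are pairwise externally tangent. For externally tangent circles $C,C'$, both externally tangent to $C_0$, let $s(C,C')$ be the *successor* of the triple $(C_0,C,C')$, i.e. the smaller of the two circles tangent to all three (the one in the bounded region enclosed by them). For $C$ externally tangent to $C_0$ let $v(C)=c-c_0$ if $C$ has center $c$, and let $v(C)$ be the unit vector pointing from $c_0$ to the point of tangency with $C_0$ if $C$ is a line; let $\ell^{1/2}(C)=\mathbb R\,v(C)^{1/2}$ be the real line through $0$ spanned by a complex square root of $v(C)$. Let $\mathcal C$ be the smallest set of circles containing $C_1,C_2$ and such that $s(C,C')\in\mathcal C$ for all tangent $C,C'\in\mathcal C$. Choose values $\alpha(C_1),\alpha(C_2)\in\mathbb R$ of the angles of $v(C_1),v(C_2)$ with the positive $x$-axis such that $|\alpha(C_1)-\alpha(C_2)|<\pi$,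 let $I$ be the closed interval with endpoints $\alpha(C_1),\alpha(C_2)$ (in either order), and for $C\in\mathcal C$ let $\alpha(C)\in I$ be the value in $I$ of the angle of $v(C)$ with the positive $x$-axis. A continuous curve $\gamma:I\to\mathbb R^2$ is an *Apollonian curve* associated to $(C_0,C_1,C_2)$ if $$\gamma(\alpha(C))-\gamma(\alpha(C'))\in \ell^{1/2}(s(C,C'))\qquad\text{for all tangent } C,C'\in\mathcal C .$$ A line $L$ is a *tangent line* of a set $\Gamma\subset\mathbb R^2$ at an accumulation point $p\in\Gamma$ of $\Gamma$ if $p\in L$ and $\operatorname{dist}(q,L)=o(|q-p|)$ as $q\to p$ within $\Gamma$. **Theorem.** Let $\gamma:I\to\mathbb R^2$ be a non-constant Apollonian curve associated to $(C_0,C_1,C_2)$. Then for every $\alpha\in I$ (endpoints included) the image of $\gamma$ has a unique tangent line at $\gamma(\alpha)$, namely the line through $\gamma(\alpha)$ at angle $\alpha/2$ to the positive $x$-axis. In particular, $\gamma$ is a convex curve: it is injective, and its image lies, for each of its tangent lines, in one of the two closed half-planes bounded by that line. -/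

import Mathlib

/-- A circle of positive radius, or a line, in the plane `ℂ`, together with the closed disc
(resp. closed half-plane) that it bounds.  `line n d` is the line `⟪n, z⟫ = d`, with unit normal
`n`, bounding the closed half-plane `d ≤ ⟪n, z⟫`. -/
inductive GenCircle : Type where
  | circle (c : ℂ) (r : ℝ) (hr : 0 < r) : GenCircle
  | line (n : ℂ) (d : ℝ) (hn : ‖n‖ = 1) : GenCircle

namespace GenCircle

/-- External tangency: the two closed discs (or half-planes) touch and have disjoint interiors.
Two lines have no finite point of tangency and are not counted as externally tangent. -/
noncomputable def ExtTangent : GenCircle → GenCircle → Prop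
  | circle c r _, circle c' r' _ => dist c c' = r + r'
  | circle c r _, line n d _ => inner ℝ n c + r = d
  | line n d _, circle c r _ => inner ℝ n c + r = d
  | line _ _ _, line _ _ _ => False

/-- The curvature `1 / r` of a circle of radius `r`; lines have curvature `0`. -/
noncomputable def curvature : GenCircle → ℝ
  | circle _ r _ => 1 / r
  | line _ _ _ => 0

/-- `S` is the successor of the triple `A, B, C` of pairwise externally tangent circles: the
smaller of the two circles tangent to all three. -/
def IsSuccessor (A B C S : GenCircle) : Prop :=
  (S.ExtTangent A ∧ S.ExtTangent B ∧ S.ExtTangent C) ∧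
    ∀ T : GenCircle, T.ExtTangent A → T.ExtTangent B → T.ExtTangent C →
      T.curvature ≤ S.curvature

/-- The vector `v(C) = c - c₀` from `c₀` to the centre `c` of `C`.  For a line it is the unit
normal pointing into its half-plane; if the line is tangent to a circle with centre `c₀` on the
other side, this is the direction from `c₀` to the point of tangency (as it is for a circle). -/
def vec (c₀ : ℂ) : GenCircle → ℂ
  | circle c _ _ => c - c₀
  | line n _ _ => n

/-- The family `𝒞` of `(C₀, C₁, C₂)`: the smallest set of circles that contains `C₁`, `C₂` and,
with any two tangent circles `C`, `C'`, the successor of the triple `(C₀, C, C')`. -/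
inductive Family (C₀ C₁ C₂ : GenCircle) : GenCircle → Prop where
  | left : Family C₀ C₁ C₂ C₁
  | right : Family C₀ C₁ C₂ C₂
  | succ (C C' S : GenCircle) : Family C₀ C₁ C₂ C → Family C₀ C₁ C₂ C' →
      C.ExtTangent C' → IsSuccessor C₀ C C' S → Family C₀ C₁ C₂ S

end GenCircle

/-- `t` is an angle (one of the values modulo `2π`) of the vector `v` with the positive
`x`-axis. -/
def IsAngleOf (t : ℝ) (v : ℂ) : Prop :=
  v ≠ 0 ∧ v = (‖v‖ : ℂ) * Complex.exp ((t : ℂ) * Complex.I)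

/-- The real line spanned by a complex square root of `v`. -/
noncomputable def sqrtLine (v : ℂ) : Submodule ℝ ℂ :=
  Submodule.span ℝ {w : ℂ | w ^ 2 = v}

/-- `γ`, restricted to the interval with endpoints `a₁` and `a₂`, is an Apollonian curve
associated to `(C₀, C₁, C₂)`, where `C₀` is the circle with centre `c₀` and radius `r₀`. Here `a₁`
and `a₂` are to be the angles of `v(C₁)` and `v(C₂)`, and the angle `α(C)` of a circle
of the family is its value in this interval. -/
structure IsApollonianCurve (c₀ : ℂ) (r₀ : ℝ) (hr₀ : 0 < r₀) (C₁ C₂ : GenCircle) (a₁ a₂ : ℝ)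
    (γ : ℝ → ℂ) : Prop where
  continuousOn : ContinuousOn γ (Set.uIcc a₁ a₂)
  sub_mem : ∀ C C' S : GenCircle,
    GenCircle.Family (.circle c₀ r₀ hr₀) C₁ C₂ C → GenCircle.Family (.circle c₀ r₀ hr₀) C₁ C₂ C' →
    C.ExtTangent C' → GenCircle.IsSuccessor (.circle c₀ r₀ hr₀) C C' S →
    ∀ t ∈ Set.uIcc a₁ a₂, ∀ t' ∈ Set.uIcc a₁ a₂,
      IsAngleOf t (C.vec c₀) → IsAngleOf t' (C'.vec c₀) →
        γ t - γ t' ∈ sqrtLine (S.vec c₀)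

/-- `L` is a tangent line of the set `Γ` at `p`: a line through `p`, where `p` is an accumulation
point of `Γ`, such that the angle between `L` and the secants from `p` to points `q ∈ Γ` tends to
zero as `q → p`, i.e. the distance from `q` to `L` is `o(|q - p|)`. -/
def IsTangentLine (Γ : Set ℂ) (p : ℂ) (L : AffineSubspace ℝ ℂ) : Prop :=
  p ∈ L ∧ Module.finrank ℝ L.direction = 1 ∧ p ∈ Γ ∧ AccPt p (Filter.principal Γ) ∧
    Asymptotics.IsLittleO (nhdsWithin p Γ) (fun q : ℂ => Metric.infDist q (L : Set ℂ))
      (fun q : ℂ => q - p)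

/-- The line through `p` at angle `θ` to the positive `x`-axis. -/
noncomputable def lineAtAngle (p : ℂ) (θ : ℝ) : AffineSubspace ℝ ℂ :=
  AffineSubspace.mk' p (Submodule.span ℝ {Complex.exp ((θ : ℂ) * Complex.I)})

/-- `γ` is a convex curve on the parameter set `I`: a simple curve whose image has a tangent
line at each of its points and lies on one side of each tangent line (in a closed half-plane
bounded by that line). -/
def IsConvexCurve (γ : ℝ → ℂ) (I : Set ℝ) : Prop :=
  ContinuousOn γ I ∧ Set.InjOn γ I ∧
    ∀ t ∈ I, (∃ L, IsTangentLine (γ '' I) (γ t) L) ∧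
      ∀ L, IsTangentLine (γ '' I) (γ t) L →
        ∃ n : ℂ, n ≠ 0 ∧ (∀ z ∈ L, inner ℝ n (z - γ t) = 0) ∧
          ∀ z ∈ γ '' I, 0 ≤ inner ℝ n (z - γ t)

/-
Every circle tangent to `C₀` has a spinor, a suitably scaled square root of its vector `v`, and two
such circles are tangent to each other exactly when their spinors span an area `1 / r₀`. Hence the
spinor of the successor of two tangent circles with spinors `u`, `u'` at a nonobtuse angle is the
mediant `u + u'`, and iterating this subdivides `I` into arbitrarily short cells, the ends of each
cell being the angles of two tangent circles. Over a cell the chord of `γ` is a multiple of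
`u + u'`. It is also the sum of the chords over the two halves, which are multiples of `2u + u'` and
`u + 2u'`. As `(2u + u') + (u + 2u') = 3(u + u')`, both factors are a third of the factor of the
whole cell, so all factors are `κ / 3 ^ n` for one constant `κ`. Up to the sign of `κ`, each chord
of `γ` therefore has an angle between the halves of the parameters of its end points, first over
cells, then by additivity and continuity over all of `I`. Tangent lines, injectivity and convexity
follow from this turning property of the chords.
-/

open Set Filter Topology Complex

attribute [local instance] Complex.finrank_real_complex_fact

local notation "ω" => Complex.orientation.areaForm

/-! ### Angles and sectors -/

theorem areaForm_exp_mul_I (a b : ℝ) : ω (exp (a * I)) (exp (b * I)) = Real.sin (b - a) := by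
  simp only [Complex.areaForm, Real.sin_sub, mul_im, conj_re, conj_im, exp_ofReal_mul_I_re,
    exp_ofReal_mul_I_im]
  ring

theorem inner_exp_mul_I (a b : ℝ) :
    inner ℝ (exp (a * I)) (exp (b * I)) = Real.cos (b - a) := by
  simp only [Complex.inner, Real.cos_sub, mul_re, conj_re, conj_im, exp_ofReal_mul_I_re,
    exp_ofReal_mul_I_im]
  ring

theorem areaForm_exp_mul_I_left {z : ℂ} {θ : ℝ} (hz : z = ‖z‖ * exp (θ * I)) (a : ℝ) :
    ω (exp (a * I)) z = ‖z‖ * Real.sin (θ - a) := by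
  conv_lhs => rw [hz, ← real_smul (x := ‖z‖), map_smul, areaForm_exp_mul_I, smul_eq_mul]

theorem inner_exp_mul_I_left {z : ℂ} {θ : ℝ} (hz : z = ‖z‖ * exp (θ * I)) (a : ℝ) :
    inner ℝ (exp (a * I)) z = ‖z‖ * Real.cos (θ - a) := by
  conv_lhs => rw [hz, ← real_smul (x := ‖z‖), inner_smul_right, inner_exp_mul_I]

theorem exists_eq_norm_mul_exp_add (c : ℝ) (z : ℂ) :
    ∃ φ : ℝ, |φ| ≤ Real.pi ∧ z = ‖z‖ * exp ((c + φ : ℝ) * I) := by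
  refine ⟨arg (exp (-c * I) * z), abs_arg_le_pi _, ?_⟩
  have h := norm_mul_exp_arg_mul_I (exp (-c * I) * z)
  rw [norm_mul, ← ofReal_neg, norm_exp_ofReal_mul_I, one_mul] at h
  rw [ofReal_add, add_mul, exp_add, mul_left_comm, ← ofReal_neg, h, ← mul_assoc, ← exp_add]
  simp

/-- The closed sector, with apex `0`, of the vectors that have an angle in `[a, b]` with the
positive `x`-axis, and of `0`. -/
def sector (a b : ℝ) : Set ℂ :=
  {z | ∃ θ ∈ Icc a b, z = ‖z‖ * exp (θ * I)}

theorem sector_mono {a b a' b' : ℝ} (ha : a' ≤ a) (hb : b ≤ b') : sector a b ⊆ sector a' b' :=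
  fun _ ⟨θ, hθ, hz⟩ => ⟨θ, Icc_subset_Icc ha hb hθ, hz⟩

theorem mul_mem_sector {a b : ℝ} {z : ℂ} (w : ℂ) (hz : z ∈ sector a b) :
    w * z ∈ sector (a + arg w) (b + arg w) := by
  obtain ⟨θ, hθ, hz⟩ := hz
  refine ⟨θ + arg w, ⟨by linarith [hθ.1], by linarith [hθ.2]⟩, ?_⟩
  conv_lhs => rw [hz, ← norm_mul_exp_arg_mul_I w]
  rw [norm_mul, ofReal_mul, ofReal_add, add_mul, exp_add]
  ring

-- For `a = b` the first two inequalities define a whole line, and the third selects a ray of it.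
theorem mem_sector_iff {a b : ℝ} (hab : a ≤ b) (hba : b < a + Real.pi) {z : ℂ} :
    z ∈ sector a b ↔ 0 ≤ ω (exp (a * I)) z ∧ ω (exp (b * I)) z ≤ 0 ∧
      0 ≤ inner ℝ (exp (((a + b) / 2 : ℝ) * I)) z := by
  constructor
  · rintro ⟨θ, ⟨hθa, hθb⟩, hz⟩
    rw [areaForm_exp_mul_I_left hz, areaForm_exp_mul_I_left hz, inner_exp_mul_I_left hz]
    refine ⟨mul_nonneg (norm_nonneg z) (Real.sin_nonneg_of_nonneg_of_le_pi ?_ ?_),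
      mul_nonpos_of_nonneg_of_nonpos (norm_nonneg z) (Real.sin_nonpos_of_nonpos_of_neg_pi_le ?_ ?_),
      mul_nonneg (norm_nonneg z) (Real.cos_nonneg_of_mem_Icc ⟨?_, ?_⟩)⟩ <;> linarith
  · rintro ⟨ha, hb, hm⟩
    obtain ⟨φ, hφ, hz⟩ := exists_eq_norm_mul_exp_add ((a + b) / 2) z
    rw [areaForm_exp_mul_I_left hz] at ha hb
    rw [inner_exp_mul_I_left hz, add_sub_cancel_left] at hm
    rcases eq_or_ne z 0 with rfl | hz0
    · exact ⟨a, left_mem_Icc.2 hab, by simp⟩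
    have hpos : 0 < ‖z‖ := norm_pos_iff.2 hz0
    have hφ2 : |φ| ≤ Real.pi / 2 := by
      by_contra! h
      rw [← Real.cos_abs] at hm
      exact (mul_neg_of_pos_of_neg hpos (Real.cos_neg_of_pi_div_two_lt_of_lt h
        (by linarith [Real.pi_pos]))).not_ge hm
    obtain ⟨h₁, h₂⟩ := abs_le.1 hφ2
    refine ⟨(a + b) / 2 + φ, ⟨?_, ?_⟩, hz⟩
    · by_contra! h
      exact (mul_neg_of_pos_of_neg hpos
        (Real.sin_neg_of_neg_of_neg_pi_lt (by linarith) (by linarith))).not_ge ha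
    · by_contra! h
      exact (mul_pos hpos (Real.sin_pos_of_pos_of_lt_pi (by linarith) (by linarith))).not_ge hb

theorem isClosed_setOf_mem_sector {X : Type*} [TopologicalSpace X] {T : Set X} (hT : IsClosed T)
    {a b : X → ℝ} {f : X → ℂ} (ha : ContinuousOn a T) (hb : ContinuousOn b T)
    (hf : ContinuousOn f T) (hab : ∀ x ∈ T, a x ≤ b x) (hba : ∀ x ∈ T, b x < a x + Real.pi) :
    IsClosed {x | x ∈ T ∧ f x ∈ sector (a x) (b x)} := by
  have hset : {x | x ∈ T ∧ f x ∈ sector (a x) (b x)} =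
      {x ∈ T | 0 ≤ ω (exp (a x * I)) (f x)} ∩ ({x ∈ T | ω (exp (b x * I)) (f x) ≤ 0} ∩
        {x ∈ T | 0 ≤ inner ℝ (exp (((a x + b x) / 2 : ℝ) * I)) (f x)}) := by
    ext x
    by_cases hx : x ∈ T
    · simp only [mem_ofPred_eq, mem_inter_iff, hx, true_and, mem_sector_iff (hab x hx) (hba x hx)]
    · simp only [mem_ofPred_eq, mem_inter_iff, hx, false_and]
  rw [hset]
  simp only [Complex.areaForm]
  refine (hT.isClosed_le continuousOn_const ?_).inter ((hT.isClosed_le ?_ continuousOn_const).inter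
    (hT.isClosed_le continuousOn_const ?_)) <;> fun_prop

theorem add_mem_sector {a b : ℝ} (hab : a ≤ b) (hba : b < a + Real.pi) {z w : ℂ}
    (hz : z ∈ sector a b) (hw : w ∈ sector a b) : z + w ∈ sector a b := by
  rw [mem_sector_iff hab hba] at hz hw ⊢
  rw [map_add, map_add, inner_add_right]
  exact ⟨add_nonneg hz.1 hw.1, add_nonpos hz.2.1 hw.2.1, add_nonneg hz.2.2 hw.2.2⟩

theorem eq_zero_of_add_eq_zero_of_mem_sector {a b : ℝ} (hba : b < a + Real.pi) {z w : ℂ}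
    (hz : z ∈ sector a b) (hw : w ∈ sector a b) (h : z + w = 0) : z = 0 := by
  have inner_pos : ∀ θ ∈ Icc a b, 0 < Real.cos (θ - (a + b) / 2) := fun θ hθ =>
    Real.cos_pos_of_mem_Ioo ⟨by linarith [hθ.1], by linarith [hθ.2]⟩
  obtain ⟨θ, hθ, hz⟩ := hz
  obtain ⟨θ', hθ', hw⟩ := hw
  have hsum := inner_add_right (𝕜 := ℝ) (exp (((a + b) / 2 : ℝ) * I)) z w
  rw [h, inner_zero_right, inner_exp_mul_I_left hz, inner_exp_mul_I_left hw, eq_comm,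
    add_eq_zero_iff_of_nonneg (mul_nonneg (norm_nonneg z) (inner_pos θ hθ).le)
      (mul_nonneg (norm_nonneg w) (inner_pos θ' hθ').le)] at hsum
  exact norm_eq_zero.1 ((mul_eq_zero.1 hsum.1).resolve_right (inner_pos θ hθ).ne')

/-! ### Lines and curves whose chords turn -/

theorem eq_inner_add_areaForm_mul_exp (θ : ℝ) (z : ℂ) :
    z = inner ℝ (exp (θ * I)) z • exp (θ * I) + ω (exp (θ * I)) z • (I * exp (θ * I)) := by
  have h := normSq_eq_conj_mul_self (z := exp (θ * I))
  rw [normSq_eq_norm_sq, norm_exp_ofReal_mul_I, one_pow, ofReal_one] at h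
  calc z = (starRingEnd ℂ (exp (θ * I)) * z) * exp (θ * I) := by
        rw [mul_right_comm, ← h, one_mul]
    _ = (inner ℝ (exp (θ * I)) z + ω (exp (θ * I)) z * I) * exp (θ * I) := by
        rw [Complex.inner, Complex.areaForm, mul_comm z, re_add_im]
    _ = _ := by
        rw [real_smul, real_smul]
        ring

theorem mem_lineAtAngle_iff {p q : ℂ} {θ : ℝ} :
    q ∈ lineAtAngle p θ ↔ ω (exp (θ * I)) (q - p) = 0 := by
  rw [lineAtAngle, AffineSubspace.mem_mk', vsub_eq_sub, Submodule.mem_span_singleton]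
  constructor
  · rintro ⟨r, hr⟩
    rw [← hr, map_smul, Orientation.areaForm_apply_self, smul_zero]
  · intro h
    refine ⟨inner ℝ (exp (θ * I)) (q - p), ?_⟩
    conv_rhs => rw [eq_inner_add_areaForm_mul_exp θ (q - p), h, zero_smul, add_zero]

theorem infDist_lineAtAngle (p q : ℂ) (θ : ℝ) :
    Metric.infDist q (lineAtAngle p θ) = |ω (exp (θ * I)) (q - p)| := by
  have hnorm := norm_exp_ofReal_mul_I θ
  apply le_antisymm
  · set foot := p + inner ℝ (exp (θ * I)) (q - p) • exp (θ * I) with hfoot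
    have mem_foot : foot ∈ lineAtAngle p θ := by
      rw [mem_lineAtAngle_iff, hfoot, add_sub_cancel_left, map_smul,
        Orientation.areaForm_apply_self, smul_zero]
    refine (Metric.infDist_le_dist_of_mem mem_foot).trans_eq ?_
    have : q - foot = ω (exp (θ * I)) (q - p) • (I * exp (θ * I)) := by
      rw [hfoot, ← sub_sub, sub_eq_iff_eq_add']
      exact eq_inner_add_areaForm_mul_exp θ (q - p)
    rw [dist_eq, this, norm_smul, norm_mul, norm_I, hnorm, one_mul, mul_one, Real.norm_eq_abs]
  · refine (Metric.le_infDist ⟨p, AffineSubspace.self_mem_mk' p _⟩).2 fun y hy => ?_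
    have : ω (exp (θ * I)) (q - p) = ω (exp (θ * I)) (q - y) := by
      rw [← sub_add_sub_cancel q y p, map_add, mem_lineAtAngle_iff.1 hy, add_zero]
    rw [this, dist_eq]
    simpa only [hnorm, one_mul] using
      Complex.orientation.abs_areaForm_le (exp (θ * I)) (q - y)

theorem lineAtAngle_eq_of_sin_eq_zero {θ θ' : ℝ} (h : Real.sin (θ' - θ) = 0) (p : ℂ) :
    lineAtAngle p θ' = lineAtAngle p θ := by
  have hcos : IsUnit (Real.cos (θ' - θ)) := by
    refine isUnit_iff_ne_zero.2 fun hcos => ?_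
    simpa only [h, hcos, zero_pow two_ne_zero, add_zero, zero_ne_one] using
      Real.sin_sq_add_cos_sq (θ' - θ)
  have hexp : exp (θ' * I) = Real.cos (θ' - θ) • exp (θ * I) := by
    conv_lhs => rw [eq_inner_add_areaForm_mul_exp θ (exp (θ' * I))]
    rw [inner_exp_mul_I, areaForm_exp_mul_I, h, zero_smul, add_zero]
  rw [lineAtAngle, lineAtAngle, hexp, Submodule.span_singleton_smul_eq hcos]

theorem finrank_direction_lineAtAngle (p : ℂ) (θ : ℝ) :
    Module.finrank ℝ (lineAtAngle p θ).direction = 1 := by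
  rw [lineAtAngle, AffineSubspace.direction_mk', finrank_span_singleton (exp_ne_zero _)]

theorem exists_eq_lineAtAngle {p : ℂ} {L : AffineSubspace ℝ ℂ} (hp : p ∈ L)
    (hL : Module.finrank ℝ L.direction = 1) : ∃ θ, L = lineAtAngle p θ := by
  obtain ⟨⟨v, hv⟩, hv0, hspan⟩ := finrank_eq_one_iff'.1 hL
  have hv0 : v ≠ 0 := fun h => hv0 (Subtype.ext h)
  refine ⟨arg v, ?_⟩
  have hdir : L.direction = Submodule.span ℝ {v} := by
    refine le_antisymm (fun w hw => ?_) ((Submodule.span_singleton_le_iff_mem _ _).2 hv)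
    obtain ⟨c, hc⟩ := hspan ⟨w, hw⟩
    exact Submodule.mem_span_singleton.2 ⟨c, congrArg Subtype.val hc⟩
  have hunit : IsUnit ‖v‖ := isUnit_iff_ne_zero.2 (norm_ne_zero_iff.2 hv0)
  rw [lineAtAngle, ← Submodule.span_singleton_smul_eq hunit, real_smul, norm_mul_exp_arg_mul_I,
    ← hdir, AffineSubspace.mk'_eq hp]

theorem norm_mul_abs_sin_le (θ θ' : ℝ) (z : ℂ) : ‖z‖ * |Real.sin (θ' - θ)| ≤
    |ω (exp (θ * I)) z| + |ω (exp (θ' * I)) z| := by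
  obtain ⟨φ, -, hz⟩ := exists_eq_norm_mul_exp_add 0 z
  rw [areaForm_exp_mul_I_left hz, areaForm_exp_mul_I_left hz, abs_mul, abs_mul, abs_norm,
    ← mul_add]
  refine mul_le_mul_of_nonneg_left ?_ (norm_nonneg z)
  have : θ' - θ = (0 + φ - θ) - (0 + φ - θ') := by ring
  rw [this, Real.sin_sub]
  refine (abs_sub _ _).trans (add_le_add ?_ ?_)
  · rw [abs_mul]
    exact mul_le_of_le_one_right (abs_nonneg _) (Real.abs_cos_le_one _)
  · rw [abs_mul]
    exact mul_le_of_le_one_left (abs_nonneg _) (Real.abs_cos_le_one _)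

theorem IsTangentLine.eq_of_lineAtAngle {Γ : Set ℂ} {p : ℂ} {L : AffineSubspace ℝ ℂ} {θ : ℝ}
    (hL : IsTangentLine Γ p L) (h : IsTangentLine Γ p (lineAtAngle p θ)) :
    L = lineAtAngle p θ := by
  obtain ⟨hp, hrank, -, hacc, hL⟩ := hL
  obtain ⟨θ', rfl⟩ := exists_eq_lineAtAngle hp hrank
  have hsum := hL.norm_left.add h.2.2.2.2.norm_left
  by_contra hne
  have hsin : 0 < |Real.sin (θ' - θ)| :=
    abs_pos.2 fun h => hne (lineAtAngle_eq_of_sin_eq_zero h p)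
  obtain ⟨q, ⟨hqp, hqΓ⟩, hq⟩ := ((accPt_iff_frequently.1 hacc).and_eventually
    (eventually_nhdsWithin_iff.1 (hsum.def (half_pos hsin)))).exists
  have := norm_mul_abs_sin_le θ θ' (q - p)
  have hpos : 0 < ‖q - p‖ := norm_pos_iff.2 (sub_ne_zero.2 hqp)
  simp only [infDist_lineAtAngle, Real.norm_eq_abs, abs_abs] at hq
  have hq := hq hqΓ
  rw [abs_of_nonneg (by positivity)] at hq
  nlinarith [mul_pos hpos hsin]

theorem map_nhdsWithin_of_injOn_of_isCompact {X Y : Type*} [TopologicalSpace X] [TopologicalSpace Y]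
    [T2Space Y] {f : X → Y} {K : Set X} (hK : IsCompact K) (hf : ContinuousOn f K)
    (hinj : InjOn f K) {x : X} (hx : x ∈ K) : map f (𝓝[K] x) = 𝓝[f '' K] (f x) := by
  have := isCompact_iff_compactSpace.1 hK
  have hemb : IsEmbedding (K.domRestrict f) :=
    (hf.domRestrict.isClosedEmbedding (injOn_iff_injective.1 hinj)).isEmbedding
  rw [nhdsWithin_eq_map_subtype_coe hx, map_map, ← range_domRestrict]
  exact hemb.map_nhds_eq ⟨x, hx⟩

/-- The chords of `F` over `J` turn with `φ`: the chord from `F s` to `F t`, for `s ≤ t`, has an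
angle between `φ s` and `φ t`. -/
def ChordsInSectors (F : ℝ → ℂ) (J : Set ℝ) (φ : ℝ → ℝ) : Prop :=
  ∀ s ∈ J, ∀ t ∈ J, s ≤ t → F t - F s ∈ sector (φ s) (φ t)

namespace ChordsInSectors

variable {F : ℝ → ℂ} {J : Set ℝ} {φ : ℝ → ℝ} {s t : ℝ}

theorem areaForm_nonneg (h : ChordsInSectors F J φ)
    (hφ : ∀ s ∈ J, ∀ t ∈ J, φ t ≤ φ s + Real.pi) (hs : s ∈ J) (ht : t ∈ J) :
    0 ≤ ω (exp (φ s * I)) (F t - F s) := by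
  rcases le_total s t with hst | hts
  · obtain ⟨θ, hθ, hz⟩ := h s hs t ht hst
    rw [areaForm_exp_mul_I_left hz]
    exact mul_nonneg (norm_nonneg _) (Real.sin_nonneg_of_nonneg_of_le_pi (by linarith [hθ.1])
      (by linarith [hθ.2, hφ s hs t ht]))
  · obtain ⟨θ, hθ, hz⟩ := h t ht s hs hts
    rw [← neg_sub, map_neg, areaForm_exp_mul_I_left hz, neg_nonneg]
    exact mul_nonpos_of_nonneg_of_nonpos (norm_nonneg _) (Real.sin_nonpos_of_nonpos_of_neg_pi_le
      (by linarith [hθ.2]) (by linarith [hθ.1, hφ t ht s hs]))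

theorem abs_areaForm_le (h : ChordsInSectors F J φ) (hs : s ∈ J) (ht : t ∈ J) :
    |ω (exp (φ s * I)) (F t - F s)| ≤ |φ t - φ s| * ‖F t - F s‖ := by
  have key : ∀ {θ : ℝ} {z : ℂ}, z = ‖z‖ * exp (θ * I) → |θ - φ s| ≤ |φ t - φ s| →
      |ω (exp (φ s * I)) z| ≤ |φ t - φ s| * ‖z‖ := fun hz hθ => by
    rw [areaForm_exp_mul_I_left hz, abs_mul, abs_norm, mul_comm]
    exact mul_le_mul_of_nonneg_right (Real.abs_sin_le_abs.trans hθ) (norm_nonneg _)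
  rcases le_total s t with hst | hts
  · obtain ⟨θ, hθ, hz⟩ := h s hs t ht hst
    exact key hz (abs_le_abs_of_nonneg (by linarith [hθ.1]) (by linarith [hθ.2]))
  · obtain ⟨θ, hθ, hz⟩ := h t ht s hs hts
    rw [← neg_sub (F s), map_neg, abs_neg, norm_neg]
    exact key hz (abs_le_abs_of_nonpos (by linarith [hθ.2]) (by linarith [hθ.1]))

theorem isTangentLine (h : ChordsInSectors F J φ) (hJ : IsCompact J) (hJ' : IsPreconnected J)
    (hJ'' : J.Nontrivial) (hF : ContinuousOn F J) (hinj : InjOn F J) (hφ : ContinuousOn φ J)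
    (hs : s ∈ J) : IsTangentLine (F '' J) (F s) (lineAtAngle (F s) (φ s)) := by
  refine ⟨AffineSubspace.self_mem_mk' _ _, finrank_direction_lineAtAngle _ _, mem_image_of_mem F hs,
    (hJ'.image F hF).preperfect_of_nontrivial (hJ''.image_of_injOn hinj) _
      (mem_image_of_mem F hs), ?_⟩
  rw [← map_nhdsWithin_of_injOn_of_isCompact hJ hF hinj hs, Asymptotics.isLittleO_map,
    Asymptotics.isLittleO_iff]
  intro c hc
  have hclose : ∀ᶠ t in 𝓝[J] s, |φ t - φ s| < c := (Metric.tendsto_nhds.1 (hφ s hs)) c hc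
  filter_upwards [hclose, self_mem_nhdsWithin] with t htc ht
  simp only [Function.comp_apply]
  rw [infDist_lineAtAngle, Real.norm_eq_abs, abs_abs]
  exact (h.abs_areaForm_le hs ht).trans (mul_le_mul_of_nonneg_right htc.le (norm_nonneg _))

theorem isConvexCurve (h : ChordsInSectors F J φ) (hJ : IsCompact J) (hJ' : IsPreconnected J)
    (hJ'' : J.Nontrivial) (hF : ContinuousOn F J) (hinj : InjOn F J) (hφ : ContinuousOn φ J)
    (hφπ : ∀ s ∈ J, ∀ t ∈ J, φ t ≤ φ s + Real.pi) : IsConvexCurve F J := by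
  refine ⟨hF, hinj, fun s hs => ?_⟩
  have tangent := h.isTangentLine hJ hJ' hJ'' hF hinj hφ hs
  refine ⟨⟨_, tangent⟩, fun L hL => ?_⟩
  obtain rfl := hL.eq_of_lineAtAngle tangent
  have inner_normal : ∀ z, inner ℝ (I * exp (φ s * I)) (z - F s) =
      ω (exp (φ s * I)) (z - F s) := fun z => by
    rw [← Complex.rightAngleRotation, ← Complex.orientation.inner_rightAngleRotation_left]
  refine ⟨I * exp (φ s * I), mul_ne_zero I_ne_zero (exp_ne_zero _), fun z hz => ?_, ?_⟩
  · rw [inner_normal, mem_lineAtAngle_iff.1 hz]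
  · rintro _ ⟨t, ht, rfl⟩
    rw [inner_normal]
    exact h.areaForm_nonneg hφπ hs ht

theorem monotoneOn (h : ChordsInSectors F J φ) : MonotoneOn φ J := fun s hs t ht hst =>
  let ⟨_, hθ, _⟩ := h s hs t ht hst
  hθ.1.trans hθ.2

theorem eq_of_eq_of_mem_Icc (h : ChordsInSectors F J φ) {x y z : ℝ} (hx : x ∈ J) (hy : y ∈ J)
    (hz : z ∈ J) (hyxz : y ∈ Icc x z) (hφ : φ z < φ x + Real.pi) (hF : F x = F z) :
    F y = F x := by
  refine sub_eq_zero.1 (eq_zero_of_add_eq_zero_of_mem_sector hφ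
    (sector_mono le_rfl (h.monotoneOn hy hz hyxz.2) (h x hx y hy hyxz.1))
    (sector_mono (h.monotoneOn hx hy hyxz.1) le_rfl (h y hy z hz hyxz.2)) ?_)
  rw [add_comm, sub_add_sub_cancel, hF, sub_self]

end ChordsInSectors

/-! ### Subdivisions of an interval -/

/-- The intervals `[s, t]` with `P n s t` are the cells of level `n` of an iterated bisection of
`[a, b]` (not necessarily at the midpoints) whose mesh tends to zero. -/
structure IsSubdivision (a b : ℝ) (P : ℕ → ℝ → ℝ → Prop) : Prop where
  root : P 0 a b
  bounds : ∀ {n s t}, P n s t → a ≤ s ∧ s ≤ t ∧ t ≤ b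
  split : ∀ {n s t}, P n s t → ∃ m, P (n + 1) s m ∧ P (n + 1) m t
  mesh : ∀ δ > 0, ∀ᶠ n in atTop, ∀ s t, P n s t → t - s < δ

namespace IsSubdivision

variable {a b : ℝ} {P : ℕ → ℝ → ℝ → Prop} {R : ℝ → ℝ → Prop} {n : ℕ} {s t x y : ℝ}

theorem exists_subcell (hP : IsSubdivision a b P) (hrefl : ∀ x ∈ Icc a b, R x x)
    (htrans : ∀ x y z, R x y → R y z → R x z) (hPR : ∀ {n s t}, P n s t → R s t)
    (h : P n s t) (hx : x ∈ Icc s t) (k : ℕ) :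
    ∃ s' t', P (n + k) s' t' ∧ x ∈ Icc s' t' ∧ R s s' ∧ R t' t := by
  induction k with
  | zero =>
    obtain ⟨has, hst, htb⟩ := hP.bounds h
    exact ⟨s, t, h, hx, hrefl s ⟨has, hst.trans htb⟩, hrefl t ⟨has.trans hst, htb⟩⟩
  | succ k ih =>
    obtain ⟨s', t', hP', hx', hs, ht⟩ := ih
    obtain ⟨m, hl, hr⟩ := hP.split hP'
    rcases le_total x m with hxm | hmx
    · exact ⟨s', m, hl, ⟨hx'.1, hxm⟩, hs, htrans _ _ _ (hPR hr) ht⟩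
    · exact ⟨m, t', hr, ⟨hmx, hx'.2⟩, htrans _ _ _ hs (hPR hl), ht⟩

theorem rel_of_mem_cell (hP : IsSubdivision a b P) (hrefl : ∀ x ∈ Icc a b, R x x)
    (htrans : ∀ x y z, R x y → R y z → R x z) (hPR : ∀ {n s t}, P n s t → R s t)
    (hclosed : IsClosed {p : ℝ × ℝ | R p.1 p.2}) (h : P n s t) (hx : x ∈ Icc s t) :
    R s x ∧ R x t := by
  have approx : ∀ ε > 0, ∃ s' t', dist x s' < ε ∧ dist x t' < ε ∧ R s s' ∧ R t' t := by
    intro ε hε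
    obtain ⟨N, hN⟩ := eventually_atTop.1 (hP.mesh ε hε)
    obtain ⟨s', t', hP', hx', hs, ht⟩ := hP.exists_subcell hrefl htrans hPR h hx N
    have := hN _ (Nat.le_add_left N n) s' t' hP'
    refine ⟨s', t', ?_, ?_, hs, ht⟩ <;>
    · rw [Real.dist_eq, abs_lt]
      constructor <;> linarith [hx'.1, hx'.2]
  constructor
  · refine (Metric.mem_of_closed' hclosed (a := (s, x))).2 fun ε hε => ?_
    obtain ⟨s', -, hs', -, hR, -⟩ := approx ε hε
    exact ⟨(s, s'), hR, by rwa [dist_prod_same_left]⟩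
  · refine (Metric.mem_of_closed' hclosed (a := (x, t))).2 fun ε hε => ?_
    obtain ⟨-, t', -, ht', -, hR⟩ := approx ε hε
    exact ⟨(t', t), hR, by rwa [dist_prod_same_right]⟩

theorem exists_separating (hP : IsSubdivision a b P) (hx : a ≤ x) (hxy : x < y) (hy : y ≤ b) :
    ∃ n s m t, P n s m ∧ P n m t ∧ x ∈ Icc s m ∧ y ∈ Icc m t := by
  by_contra! hsep
  have common_cell : ∀ n, ∃ s t, P n s t ∧ s ≤ x ∧ y ≤ t := by
    intro n
    induction n with
    | zero => exact ⟨a, b, hP.root, hx, hy⟩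
    | succ n ih =>
      obtain ⟨s, t, h, hsx, hyt⟩ := ih
      obtain ⟨m, hl, hr⟩ := hP.split h
      rcases le_or_gt y m with hym | hmy
      · exact ⟨s, m, hl, hsx, hym⟩
      rcases le_or_gt x m with hxm | hmx
      · exact absurd ⟨hmy.le, hyt⟩ (hsep _ s m t hl hr ⟨hsx, hxm⟩)
      · exact ⟨m, t, hr, hmx.le, hyt⟩
  obtain ⟨n, hn⟩ := (hP.mesh (y - x) (sub_pos.2 hxy)).exists
  obtain ⟨s, t, h, hsx, hyt⟩ := common_cell n
  linarith [hn s t h]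

theorem rel_of_le (hP : IsSubdivision a b P) (hrefl : ∀ x ∈ Icc a b, R x x)
    (htrans : ∀ x y z, R x y → R y z → R x z) (hPR : ∀ {n s t}, P n s t → R s t)
    (hclosed : IsClosed {p : ℝ × ℝ | R p.1 p.2}) (hx : a ≤ x) (hxy : x ≤ y) (hy : y ≤ b) :
    R x y := by
  rcases hxy.eq_or_lt with rfl | hlt
  · exact hrefl x ⟨hx, hy⟩
  obtain ⟨n, s, m, t, hl, hr, hxs, hyt⟩ := hP.exists_separating hx hlt hy
  exact htrans _ _ _ (hP.rel_of_mem_cell hrefl htrans hPR hclosed hl hxs).2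
    (hP.rel_of_mem_cell hrefl htrans hPR hclosed hr hyt).1

theorem exists_cell_between (hP : IsSubdivision a b P) (hx : a ≤ x) (hxy : x < y) (hy : y ≤ b) :
    ∃ n s t, P n s t ∧ x ≤ s ∧ t ≤ y := by
  obtain ⟨N, hN⟩ := eventually_atTop.1 (hP.mesh ((y - x) / 2) (by linarith))
  obtain ⟨s, t, h, hm, -⟩ := hP.exists_subcell (R := fun _ _ => True) (fun _ _ => trivial)
    (fun _ _ _ _ _ => trivial) (fun _ => trivial) hP.root
    (x := (x + y) / 2) ⟨by linarith, by linarith⟩ N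
  have := hN _ (Nat.le_add_left N 0) s t h
  exact ⟨_, s, t, h, by linarith [hm.2], by linarith [hm.1]⟩

end IsSubdivision

namespace IsSubdivision

variable {a b : ℝ} {P : ℕ → ℝ → ℝ → Prop} {F : ℝ → ℂ} {φ : ℝ → ℝ}

theorem chordsInSectors (hP : IsSubdivision a b P) (hF : ContinuousOn F (Icc a b))
    (hφ : ContinuousOn φ (Icc a b)) (hmono : MonotoneOn φ (Icc a b)) (hφπ : φ b < φ a + Real.pi)
    (hchord : ∀ {n s t}, P n s t → F t - F s ∈ sector (φ s) (φ t)) :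
    ChordsInSectors F (Icc a b) φ := by
  set T : Set (ℝ × ℝ) := {p | p ∈ Icc a b ×ˢ Icc a b ∧ p.1 ≤ p.2}
  have width : ∀ {x y}, (x, y) ∈ T → φ x ≤ φ y ∧ φ y < φ x + Real.pi := fun {x y} h => by
    obtain ⟨⟨hx, hy⟩, hxy⟩ := h
    have hab : a ≤ b := hx.1.trans hx.2
    have := hmono (left_mem_Icc.2 hab) hx hx.1
    have := hmono hy (right_mem_Icc.2 hab) hy.2
    exact ⟨hmono hx hy hxy, by linarith⟩
  set R : ℝ → ℝ → Prop := fun x y => (x, y) ∈ T ∧ F y - F x ∈ sector (φ x) (φ y)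
  have hrefl : ∀ x ∈ Icc a b, R x x := fun x hx =>
    ⟨⟨⟨hx, hx⟩, le_rfl⟩, φ x, left_mem_Icc.2 le_rfl, by simp⟩
  have htrans : ∀ x y z, R x y → R y z → R x z := by
    rintro x y z ⟨hxy, hF₁⟩ ⟨hyz, hF₂⟩
    have hxz : (x, z) ∈ T := ⟨⟨hxy.1.1, hyz.1.2⟩, hxy.2.trans hyz.2⟩
    refine ⟨hxz, ?_⟩
    rw [← sub_add_sub_cancel (F z) (F y)]
    exact add_mem_sector (width hxz).1 (width hxz).2 (sector_mono (width hxy).1 le_rfl hF₂)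
      (sector_mono le_rfl (width hyz).1 hF₁)
  have hPR : ∀ {n s t}, P n s t → R s t := fun h =>
    have ⟨has, hst, htb⟩ := hP.bounds h
    ⟨⟨⟨⟨has, hst.trans htb⟩, ⟨has.trans hst, htb⟩⟩, hst⟩, hchord h⟩
  have hclosed : IsClosed {p : ℝ × ℝ | R p.1 p.2} := by
    have h₁ : MapsTo Prod.fst T (Icc a b) := fun p hp => hp.1.1
    have h₂ : MapsTo Prod.snd T (Icc a b) := fun p hp => hp.1.2
    exact isClosed_setOf_mem_sector
      ((isClosed_Icc.prod isClosed_Icc).inter (isClosed_le continuous_fst continuous_snd))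
      (hφ.comp continuousOn_fst h₁) (hφ.comp continuousOn_snd h₂)
      ((hF.comp continuousOn_snd h₂).sub (hF.comp continuousOn_fst h₁))
      (fun p hp => (width hp).1) (fun p hp => (width hp).2)
  exact fun s hs t ht hst => (hP.rel_of_le hrefl htrans hPR hclosed hs.1 hst ht.2).2

theorem injOn_of_chordsInSectors (hP : IsSubdivision a b P) (h : ChordsInSectors F (Icc a b) φ)
    (hφπ : φ b < φ a + Real.pi) (hne : ∀ {n s t}, P n s t → F s ≠ F t) :
    InjOn F (Icc a b) := by
  have lt_imp_ne : ∀ x ∈ Icc a b, ∀ y ∈ Icc a b, x < y → F x ≠ F y := by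
    intro x hx y hy hxy heq
    obtain ⟨n, s, t, hst, hxs, hty⟩ := hP.exists_cell_between hx.1 hxy hy.2
    have hle := (hP.bounds hst).2.1
    have hab : a ≤ b := hx.1.trans hx.2
    have hwidth : φ y < φ x + Real.pi := by
      have := h.monotoneOn (left_mem_Icc.2 hab) hx hx.1
      have := h.monotoneOn hy (right_mem_Icc.2 hab) hy.2
      linarith
    have constant : ∀ z ∈ Icc x y, F z = F x := fun z hz =>
      h.eq_of_eq_of_mem_Icc hx (Icc_subset_Icc hx.1 hy.2 hz) hy hz hwidth heq
    exact hne hst ((constant s ⟨hxs, hle.trans hty⟩).trans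
      (constant t ⟨hxs.trans hle, hty⟩).symm)
  intro x hx y hy heq
  by_contra hxy
  rcases lt_or_gt_of_ne hxy with h | h
  · exact lt_imp_ne x hx y hy h heq
  · exact lt_imp_ne y hy x hx h heq.symm

end IsSubdivision

/-! ### Spinors of tangent circles -/

namespace IsAngleOf

theorem ofReal_mul {θ r : ℝ} {v : ℂ} (hr : 0 < r) (h : IsAngleOf θ v) : IsAngleOf θ (r * v) := by
  refine ⟨mul_ne_zero (ofReal_ne_zero.2 hr.ne') h.1, ?_⟩
  rw [norm_mul, Complex.norm_of_nonneg hr.le, Complex.ofReal_mul, mul_assoc, ← h.2]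

theorem sq {θ : ℝ} {v : ℂ} (h : IsAngleOf (θ / 2) v) : IsAngleOf θ (v ^ 2) := by
  refine ⟨pow_ne_zero 2 h.1, ?_⟩
  conv_lhs => rw [h.2, mul_pow, ← ofReal_pow, ← norm_pow, ← exp_nat_mul]
  congr 2
  push_cast
  ring

theorem exists_sq_eq {θ : ℝ} {v : ℂ} (h : IsAngleOf θ v) :
    ∃ u, u ^ 2 = v ∧ IsAngleOf (θ / 2) u := by
  have hpos : 0 < √‖v‖ := Real.sqrt_pos.2 (norm_pos_iff.2 h.1)
  have hexp : IsAngleOf (θ / 2) (exp ((θ / 2 : ℝ) * I)) :=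
    ⟨exp_ne_zero _, by rw [norm_exp_ofReal_mul_I, ofReal_one, one_mul]⟩
  refine ⟨√‖v‖ * exp ((θ / 2 : ℝ) * I), ?_, hexp.ofReal_mul hpos⟩
  conv_rhs => rw [h.2]
  rw [mul_pow, ← ofReal_pow, Real.sq_sqrt (norm_nonneg v), ← exp_nat_mul]
  congr 2
  push_cast
  ring

theorem areaForm_eq {α β : ℝ} {v w : ℂ} (hv : IsAngleOf α v) (hw : IsAngleOf β w) :
    ω v w = ‖v‖ * ‖w‖ * Real.sin (β - α) := by
  conv_lhs => rw [hv.2, ← real_smul, map_smul, LinearMap.smul_apply,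
    areaForm_exp_mul_I_left hw.2, smul_eq_mul, ← mul_assoc]

theorem inner_eq {α β : ℝ} {v w : ℂ} (hv : IsAngleOf α v) (hw : IsAngleOf β w) :
    inner ℝ v w = ‖v‖ * ‖w‖ * Real.cos (β - α) := by
  conv_lhs => rw [hv.2, ← real_smul, real_inner_smul_left, inner_exp_mul_I_left hw.2, ← mul_assoc]

theorem mem_sector {θ a b : ℝ} {v : ℂ} (h : IsAngleOf θ v) (hθ : θ ∈ Icc a b) : v ∈ sector a b :=
  ⟨θ, hθ, h.2⟩

end IsAngleOf

theorem inner_ofReal_mul_sq (s s' : ℝ) (u u' : ℂ) :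
    inner ℝ ((s : ℂ) * u ^ 2) ((s' : ℂ) * u' ^ 2) =
      s * s' * (‖u‖ ^ 2 * ‖u'‖ ^ 2 - 2 * ω u u' ^ 2) := by
  rw [← normSq_eq_norm_sq, ← normSq_eq_norm_sq]
  simp only [Complex.areaForm, Complex.inner, normSq_apply, map_mul, conj_ofReal, pow_two,
    mul_re, mul_im, ofReal_re, ofReal_im, conj_re, conj_im]
  ring

theorem areaForm_smul_eq_sub (u v w : ℂ) : ω u v • w = ω w v • u - ω w u • v := by
  apply Complex.ext <;>
  · simp only [Complex.areaForm, real_smul, sub_re, sub_im, mul_re, mul_im, ofReal_re, ofReal_im,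
      conj_re, conj_im]
    ring

theorem eq_div_three_of_smul_add_smul_eq {u v : ℂ} (huv : ω u v ≠ 0) {k l m : ℝ}
    (h : k • (u + (u + v)) + l • (u + v + v) = m • (u + v)) : k = m / 3 ∧ l = m / 3 := by
  have coeff_right : k + 2 * l = m := by
    apply mul_right_cancel₀ huv
    have := congrArg (ω u) h
    simp only [map_add, map_smul, Orientation.areaForm_apply_self, smul_eq_mul] at this
    linarith
  have coeff_left : 2 * k + l = m := by
    apply mul_right_cancel₀ huv
    have := congrArg (ω v) h
    simp only [map_add, map_smul, Orientation.areaForm_apply_self, smul_eq_mul,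
      Orientation.areaForm_swap (x := v) (y := u)] at this
    linarith
  constructor <;> linarith

theorem norm_le_norm_add_of_areaForm_sq_eq {u v w : ℂ} (huv : ω u v ≠ 0)
    (hu : ω w u ^ 2 = ω u v ^ 2) (hv : ω w v ^ 2 = ω u v ^ 2) (hinner : 0 ≤ inner ℝ u v) :
    ‖w‖ ≤ ‖u + v‖ := by
  have hscaled : ω u v ^ 2 * ‖w‖ ^ 2 ≤ ω u v ^ 2 * ‖u + v‖ ^ 2 := by
    calc ω u v ^ 2 * ‖w‖ ^ 2
      _ = ‖ω u v • w‖ ^ 2 := by rw [norm_smul, mul_pow, Real.norm_eq_abs, sq_abs]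
      _ = ω u v ^ 2 * (‖u‖ ^ 2 + ‖v‖ ^ 2) - 2 * (ω w v * ω w u * inner ℝ u v) := by
        rw [areaForm_smul_eq_sub, norm_sub_sq_real, norm_smul, norm_smul, mul_pow, mul_pow,
          Real.norm_eq_abs, Real.norm_eq_abs, sq_abs, sq_abs, hu, hv, real_inner_smul_left,
          real_inner_smul_right]
        ring
      _ ≤ ω u v ^ 2 * ‖u + v‖ ^ 2 := by
        rw [norm_add_sq_real]
        have hprod : 0 ≤ (ω w u + ω w v) ^ 2 * inner ℝ u v := by positivity
        rw [add_sq, hu, hv] at hprod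
        linarith
  exact le_of_sq_le_sq (le_of_mul_le_mul_left hscaled (by positivity)) (norm_nonneg _)

namespace GenCircle

variable {c₀ : ℂ} {r₀ : ℝ} {hr₀ : 0 < r₀} {C C' C₁ C₂ : GenCircle} {u u' : ℂ}

theorem ExtTangent.symm (h : C.ExtTangent C') : C'.ExtTangent C := by
  cases C <;> cases C' <;> simp only [ExtTangent] at h ⊢
  · rw [dist_comm, h, add_comm]
  all_goals exact h

theorem curvature_nonneg (C : GenCircle) : 0 ≤ C.curvature := by
  cases C with
  | circle c r hr => exact (one_div_pos.2 hr).le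
  | line n d hn => exact le_rfl

/-- The factor between the square of a spinor of `C` and the vector of `C`. It is chosen such that
spinors of tangent circles span an area independent of the circles. -/
def spinorScale (r₀ : ℝ) : GenCircle → ℝ
  | circle _ r _ => r * r₀
  | line _ _ _ => r₀

/-- `u` is a spinor of `C`, a circle externally tangent to the circle with centre `c₀` and radius
`r₀`: a square root, determined up to sign, of a suitable positive multiple of `v(C)`. -/
def IsSpinor (c₀ : ℂ) (r₀ : ℝ) (hr₀ : 0 < r₀) (C : GenCircle) (u : ℂ) : Prop :=
  (spinorScale r₀ C : ℂ) * u ^ 2 = C.vec c₀ ∧ (circle c₀ r₀ hr₀).ExtTangent C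

theorem spinorScale_pos (hr₀ : 0 < r₀) (C : GenCircle) : 0 < spinorScale r₀ C := by
  cases C with
  | circle c r hr => exact mul_pos hr hr₀
  | line n d hn => exact hr₀

namespace IsSpinor

theorem isAngleOf_vec {t : ℝ} (h : IsSpinor c₀ r₀ hr₀ C u) (hu : IsAngleOf (t / 2) u) :
    IsAngleOf t (C.vec c₀) :=
  h.1 ▸ hu.sq.ofReal_mul (spinorScale_pos hr₀ C)

theorem sqrtLine_le (h : IsSpinor c₀ r₀ hr₀ C u) :
    sqrtLine (C.vec c₀) ≤ Submodule.span ℝ {u} := by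
  refine Submodule.span_le.2 fun w hw => Submodule.mem_span_singleton.2 ?_
  have hsq : w ^ 2 = (√(spinorScale r₀ C) • u) ^ 2 := by
    rw [real_smul, mul_pow, ← ofReal_pow, Real.sq_sqrt (spinorScale_pos hr₀ C).le, h.1]
    exact hw
  rcases sq_eq_sq_iff_eq_or_eq_neg.1 hsq with rfl | rfl
  · exact ⟨√(spinorScale r₀ C), rfl⟩
  · exact ⟨-√(spinorScale r₀ C), neg_smul _ _⟩

theorem norm_sq_eq (h : IsSpinor c₀ r₀ hr₀ C u) : ‖u‖ ^ 2 = C.curvature + 1 / r₀ := by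
  obtain ⟨hu, ht⟩ := h
  have hnorm := congrArg norm hu
  rw [norm_mul, norm_pow, Complex.norm_of_nonneg (spinorScale_pos hr₀ C).le] at hnorm
  cases C with
  | circle c r hr =>
    simp only [ExtTangent, spinorScale, vec, curvature] at *
    rw [← dist_eq, dist_comm, ht] at hnorm
    field_simp
    linarith
  | line n d hn =>
    simp only [spinorScale, vec, curvature] at *
    rw [hn] at hnorm
    field_simp
    linarith

theorem one_div_le_norm_sq (h : IsSpinor c₀ r₀ hr₀ C u) : 1 / r₀ ≤ ‖u‖ ^ 2 := by
  linarith [h.norm_sq_eq, C.curvature_nonneg]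

theorem inner_vec (h : IsSpinor c₀ r₀ hr₀ C u) (h' : IsSpinor c₀ r₀ hr₀ C' u') :
    inner ℝ (C.vec c₀) (C'.vec c₀) = spinorScale r₀ C * spinorScale r₀ C' *
      ((C.curvature + 1 / r₀) * (C'.curvature + 1 / r₀) - 2 * ω u u' ^ 2) := by
  rw [← h.1, ← h'.1, inner_ofReal_mul_sq, h.norm_sq_eq, h'.norm_sq_eq]

theorem extTangent_iff (hC : 0 < C.curvature) (h : IsSpinor c₀ r₀ hr₀ C u)
    (h' : IsSpinor c₀ r₀ hr₀ C' u') : C.ExtTangent C' ↔ ω u u' ^ 2 = (1 / r₀) ^ 2 := by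
  have hinner := h.inner_vec h'
  have htan := h.2
  have htan' := h'.2
  cases C with
  | line n d hn => exact absurd hC (lt_irrefl _)
  | circle c r hr =>
  cases C' with
  | circle c' r' hr' =>
    simp only [ExtTangent, spinorScale, vec, curvature] at *
    rw [dist_comm, dist_eq] at htan htan'
    have hdist : dist c c' ^ 2 - (r + r') ^ 2 =
        4 * r * r' * r₀ ^ 2 * (ω u u' ^ 2 - (1 / r₀) ^ 2) := by
      rw [dist_eq, ← sub_sub_sub_cancel_right c c' c₀, norm_sub_sq_real, htan, htan', hinner]
      field_simp
      ring
    have hpos : 4 * r * r' * r₀ ^ 2 ≠ 0 := by positivity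
    rw [← sq_eq_sq₀ dist_nonneg (by positivity), ← sub_eq_zero, hdist, mul_eq_zero,
      or_iff_right hpos, sub_eq_zero]
  | line n d hn =>
    simp only [ExtTangent, spinorScale, vec, curvature] at *
    have hdist : inner ℝ n c + r - d = 2 * r * r₀ ^ 2 * ((1 / r₀) ^ 2 - ω u u' ^ 2) := by
      rw [← htan', ← sub_add_cancel c c₀, inner_add_right, real_inner_comm, hinner]
      field_simp
      ring
    have hpos : 2 * r * r₀ ^ 2 ≠ 0 := by positivity
    rw [← sub_eq_zero, hdist, mul_eq_zero, or_iff_right hpos, sub_eq_zero, eq_comm]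

theorem areaForm_sq (h : IsSpinor c₀ r₀ hr₀ C u) (h' : IsSpinor c₀ r₀ hr₀ C' u')
    (ht : C.ExtTangent C') : ω u u' ^ 2 = (1 / r₀) ^ 2 := by
  cases C with
  | circle c r hr => exact (extTangent_iff (C := circle c r hr) (one_div_pos.2 hr) h h').1 ht
  | line n d hn =>
    cases C' with
    | circle c r hr =>
      rw [Orientation.areaForm_swap, neg_sq]
      exact (extTangent_iff (C := circle c r hr) (one_div_pos.2 hr) h' h).1 ht.symm
    | line n' d' hn' => exact ht.elim

end IsSpinor

theorem exists_isSpinor_isAngleOf {a : ℝ} (h : (circle c₀ r₀ hr₀).ExtTangent C)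
    (ha : IsAngleOf a (C.vec c₀)) : ∃ u, IsSpinor c₀ r₀ hr₀ C u ∧ IsAngleOf (a / 2) u := by
  have hs := spinorScale_pos hr₀ C
  obtain ⟨u, hu, hangle⟩ := (ha.ofReal_mul (inv_pos.2 hs)).exists_sq_eq
  refine ⟨u, ⟨?_, h⟩, hangle⟩
  rw [hu, ← mul_assoc, ← ofReal_mul, mul_inv_cancel₀ hs.ne', ofReal_one, one_mul]

theorem exists_isSpinor (h : (circle c₀ r₀ hr₀).ExtTangent C) : ∃ u, IsSpinor c₀ r₀ hr₀ C u := by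
  have hs : (spinorScale r₀ C : ℂ) ≠ 0 := ofReal_ne_zero.2 (spinorScale_pos hr₀ C).ne'
  obtain ⟨u, hu⟩ := IsAlgClosed.exists_pow_nat_eq (C.vec c₀ / spinorScale r₀ C) two_pos
  exact ⟨u, by rw [hu, mul_div_cancel₀ _ hs], h⟩

theorem exists_isSpinor_of_lt_norm_sq (c₀ : ℂ) (hr₀ : 0 < r₀) (hu : 1 / r₀ < ‖u‖ ^ 2) :
    ∃ S : GenCircle, 0 < S.curvature ∧ IsSpinor c₀ r₀ hr₀ S u := by
  obtain ⟨r, hr, hnorm⟩ : ∃ r : ℝ, 0 < r ∧ ‖u‖ ^ 2 = 1 / r + 1 / r₀ :=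
    ⟨1 / (‖u‖ ^ 2 - 1 / r₀), one_div_pos.2 (sub_pos.2 hu), by rw [one_div_one_div, sub_add_cancel]⟩
  refine ⟨circle (c₀ + (r * r₀ : ℝ) * u ^ 2) r hr, one_div_pos.2 hr, ?_, ?_⟩
  · simp only [spinorScale, vec, add_sub_cancel_left]
  · simp only [ExtTangent]
    rw [dist_self_add_right, norm_mul, norm_pow, Complex.norm_of_nonneg (by positivity), hnorm]
    field_simp

theorem IsSpinor.exists_isSuccessor (h : IsSpinor c₀ r₀ hr₀ C u) (h' : IsSpinor c₀ r₀ hr₀ C' u')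
    (ht : C.ExtTangent C') (hinner : 0 ≤ inner ℝ u u') :
    ∃ S, IsSpinor c₀ r₀ hr₀ S (u + u') ∧ IsSuccessor (circle c₀ r₀ hr₀) C C' S := by
  have harea := h.areaForm_sq h' ht
  have hr : 0 < 1 / r₀ := one_div_pos.2 hr₀
  obtain ⟨S, hS, hSu⟩ := exists_isSpinor_of_lt_norm_sq c₀ hr₀ (u := u + u') (by
    rw [norm_add_sq_real]
    linarith [h.one_div_le_norm_sq, h'.one_div_le_norm_sq])
  have tangent : S.ExtTangent C := (extTangent_iff hS hSu h).2 (by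
    rw [map_add, LinearMap.add_apply, Orientation.areaForm_apply_self, zero_add,
      Orientation.areaForm_swap, neg_sq, harea])
  have tangent' : S.ExtTangent C' := (extTangent_iff hS hSu h').2 (by
    rw [map_add, LinearMap.add_apply, Orientation.areaForm_apply_self, add_zero, harea])
  refine ⟨S, hSu, ⟨hSu.2.symm, tangent, tangent'⟩, fun T hT₀ hT hT' => ?_⟩
  obtain ⟨w, hw⟩ := exists_isSpinor hT₀.symm
  have hle := norm_le_norm_add_of_areaForm_sq_eq (fun h0 => by
      rw [h0, zero_pow two_ne_zero] at harea
      exact (pow_pos hr 2).ne harea)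
    ((hw.areaForm_sq h hT).trans harea.symm) ((hw.areaForm_sq h' hT').trans harea.symm) hinner
  have := pow_le_pow_left₀ (norm_nonneg w) hle 2
  linarith [hw.norm_sq_eq, hSu.norm_sq_eq]

end GenCircle

/-! ### The subdivision by the angles of the family -/

section

variable {c₀ : ℂ} {r₀ : ℝ} {hr₀ : 0 < r₀} {C₁ C₂ : GenCircle} {u u' : ℂ} {a₁ a₂ s t κ : ℝ}
  {γ : ℝ → ℂ} {n : ℕ}

open GenCircle

/-- `u` and `u'` are spinors, at an angle of at most `π / 2`, of two tangent circles of the family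
of `(C₀, C₁, C₂)`, where `C₀` is the circle with centre `c₀` and radius `r₀`. -/
def IsTangentPair (c₀ : ℂ) (r₀ : ℝ) (hr₀ : 0 < r₀) (C₁ C₂ : GenCircle) (u u' : ℂ) : Prop :=
  ∃ C C', Family (circle c₀ r₀ hr₀) C₁ C₂ C ∧ Family (circle c₀ r₀ hr₀) C₁ C₂ C' ∧
    C.ExtTangent C' ∧ IsSpinor c₀ r₀ hr₀ C u ∧ IsSpinor c₀ r₀ hr₀ C' u' ∧ 0 ≤ inner ℝ u u'

namespace IsTangentPair

theorem areaForm_sq (h : IsTangentPair c₀ r₀ hr₀ C₁ C₂ u u') : ω u u' ^ 2 = (1 / r₀) ^ 2 :=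
  have ⟨_, _, _, _, ht, hu, hu', _⟩ := h
  hu.areaForm_sq hu' ht

theorem areaForm_ne_zero (h : IsTangentPair c₀ r₀ hr₀ C₁ C₂ u u') : ω u u' ≠ 0 := fun h0 => by
  have harea := h.areaForm_sq
  rw [h0, zero_pow two_ne_zero] at harea
  exact (pow_pos (one_div_pos.2 hr₀) 2).ne harea

theorem add_ne_zero (h : IsTangentPair c₀ r₀ hr₀ C₁ C₂ u u') : u + u' ≠ 0 := fun h0 => by
  apply h.areaForm_ne_zero
  rw [eq_neg_of_add_eq_zero_right h0, map_neg, Orientation.areaForm_apply_self, neg_zero]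

theorem inner_nonneg (h : IsTangentPair c₀ r₀ hr₀ C₁ C₂ u u') : 0 ≤ inner ℝ u u' :=
  have ⟨_, _, _, _, _, _, _, hinner⟩ := h
  hinner

theorem one_div_le_norm_sq (h : IsTangentPair c₀ r₀ hr₀ C₁ C₂ u u') :
    1 / r₀ ≤ ‖u‖ ^ 2 ∧ 1 / r₀ ≤ ‖u'‖ ^ 2 :=
  have ⟨_, _, _, _, _, hu, hu', _⟩ := h
  ⟨hu.one_div_le_norm_sq, hu'.one_div_le_norm_sq⟩

theorem mediant_left (h : IsTangentPair c₀ r₀ hr₀ C₁ C₂ u u') :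
    IsTangentPair c₀ r₀ hr₀ C₁ C₂ u (u + u') := by
  obtain ⟨C, C', hC, hC', ht, hu, hu', hinner⟩ := h
  obtain ⟨S, hSu, hS⟩ := hu.exists_isSuccessor hu' ht hinner
  refine ⟨C, S, hC, .succ C C' S hC hC' ht hS, hS.1.2.1.symm, hu, hSu, ?_⟩
  rw [inner_add_right]
  exact add_nonneg real_inner_self_nonneg hinner

theorem mediant_right (h : IsTangentPair c₀ r₀ hr₀ C₁ C₂ u u') :
    IsTangentPair c₀ r₀ hr₀ C₁ C₂ (u + u') u' := by
  obtain ⟨C, C', hC, hC', ht, hu, hu', hinner⟩ := h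
  obtain ⟨S, hSu, hS⟩ := hu.exists_isSuccessor hu' ht hinner
  refine ⟨S, C', .succ C C' S hC hC' ht hS, hC', hS.1.2.2, hSu, hu', ?_⟩
  rw [inner_add_left]
  exact add_nonneg hinner real_inner_self_nonneg

theorem exists_chord_eq_smul (h : IsTangentPair c₀ r₀ hr₀ C₁ C₂ u u')
    (hγ : IsApollonianCurve c₀ r₀ hr₀ C₁ C₂ a₁ a₂ γ) (hs : s ∈ uIcc a₁ a₂) (ht : t ∈ uIcc a₁ a₂)
    (hsu : IsAngleOf (s / 2) u) (htu : IsAngleOf (t / 2) u') :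
    ∃ k : ℝ, γ t - γ s = k • (u + u') := by
  obtain ⟨C, C', hC, hC', htan, hu, hu', hinner⟩ := h
  obtain ⟨S, hSu, hS⟩ := hu.exists_isSuccessor hu' htan hinner
  obtain ⟨k, hk⟩ := Submodule.mem_span_singleton.1 (hSu.sqrtLine_le
    (hγ.sub_mem C C' S hC hC' htan hS s hs t ht (hu.isAngleOf_vec hsu) (hu'.isAngleOf_vec htu)))
  exact ⟨-k, by rw [neg_smul, hk, neg_sub]⟩

theorem mul_sin_sq_le_one (h : IsTangentPair c₀ r₀ hr₀ C₁ C₂ u u') {α β : ℝ} (hα : IsAngleOf α u)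
    (hβ : IsAngleOf β u') {x : ℝ} (hx : (x + 1) / r₀ ≤ ‖u‖ ^ 2 + ‖u'‖ ^ 2) :
    x * Real.sin (β - α) ^ 2 ≤ 1 := by
  have hr : 0 < 1 / r₀ := one_div_pos.2 hr₀
  have hnorm : x * (1 / r₀) ^ 2 ≤ ‖u‖ ^ 2 * ‖u'‖ ^ 2 := by
    obtain ⟨hu, hu'⟩ := h.one_div_le_norm_sq
    have hprod := mul_nonneg (sub_nonneg.2 hu) (sub_nonneg.2 hu')
    rw [div_eq_mul_one_div] at hx
    linarith [mul_le_mul_of_nonneg_left hx hr.le]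
  refine le_of_mul_le_mul_right ?_ (pow_pos hr 2)
  calc x * Real.sin (β - α) ^ 2 * (1 / r₀) ^ 2 = x * (1 / r₀) ^ 2 * Real.sin (β - α) ^ 2 := by ring
    _ ≤ ‖u‖ ^ 2 * ‖u'‖ ^ 2 * Real.sin (β - α) ^ 2 := by gcongr
    _ = ω u u' ^ 2 := by rw [hα.areaForm_eq hβ, mul_pow, mul_pow]
    _ = 1 * (1 / r₀) ^ 2 := by rw [h.areaForm_sq, one_mul]

end IsTangentPair

theorem exists_isTangentPair (h₁ : (circle c₀ r₀ hr₀).ExtTangent C₁)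
    (h₂ : (circle c₀ r₀ hr₀).ExtTangent C₂) (h₁₂ : C₁.ExtTangent C₂)
    (ha₁ : IsAngleOf a₁ (C₁.vec c₀)) (ha₂ : IsAngleOf a₂ (C₂.vec c₀)) (ha : |a₁ - a₂| < Real.pi) :
    ∃ u u', IsTangentPair c₀ r₀ hr₀ C₁ C₂ u u' ∧ IsAngleOf (a₁ / 2) u ∧ IsAngleOf (a₂ / 2) u' := by
  obtain ⟨u, hu, hau⟩ := exists_isSpinor_isAngleOf h₁ ha₁
  obtain ⟨u', hu', hau'⟩ := exists_isSpinor_isAngleOf h₂ ha₂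
  obtain ⟨hlt, hgt⟩ := abs_lt.1 ha
  refine ⟨u, u', ⟨C₁, C₂, .left, .right, h₁₂, hu, hu', ?_⟩, hau, hau'⟩
  rw [hau.inner_eq hau']
  exact mul_nonneg (by positivity) (Real.cos_nonneg_of_mem_Icc ⟨by linarith, by linarith⟩)

/-- `[s, t]` is a cell of level `n` of the subdivision of `[a₁, a₂]` by the angles of the circles
of the family, and the chord of `γ` over it is `κ / 3 ^ n` times the sum of the spinors of the two
circles at its ends. -/
def IsCell (c₀ : ℂ) (r₀ : ℝ) (hr₀ : 0 < r₀) (C₁ C₂ : GenCircle) (a₁ a₂ : ℝ) (γ : ℝ → ℂ) (κ : ℝ)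
    (n : ℕ) (s t : ℝ) : Prop :=
  ∃ u u', IsTangentPair c₀ r₀ hr₀ C₁ C₂ u u' ∧ (s ∈ Icc a₁ a₂ ∧ t ∈ Icc a₁ a₂ ∧ s ≤ t) ∧
    IsAngleOf (s / 2) u ∧ IsAngleOf (t / 2) u' ∧ (n + 2) / r₀ ≤ ‖u‖ ^ 2 + ‖u'‖ ^ 2 ∧
    γ t - γ s = (κ / 3 ^ n) • (u + u')

namespace IsCell

theorem split (hγ : IsApollonianCurve c₀ r₀ hr₀ C₁ C₂ a₁ a₂ γ) (ha : a₂ < a₁ + Real.pi)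
    (h : IsCell c₀ r₀ hr₀ C₁ C₂ a₁ a₂ γ κ n s t) :
    ∃ m, IsCell c₀ r₀ hr₀ C₁ C₂ a₁ a₂ γ κ (n + 1) s m ∧
      IsCell c₀ r₀ hr₀ C₁ C₂ a₁ a₂ γ κ (n + 1) m t := by
  obtain ⟨u, u', huu', ⟨hs, ht, hst⟩, hsu, htu, hnorm, hchord⟩ := h
  obtain ⟨θ, ⟨hsθ, hθt⟩, hθ⟩ : u + u' ∈ sector (s / 2) (t / 2) :=
    add_mem_sector (by linarith) (by linarith [hs.1, ht.2, Real.pi_pos])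
      (hsu.mem_sector ⟨le_rfl, by linarith⟩) (htu.mem_sector ⟨by linarith, le_rfl⟩)
  obtain ⟨m, rfl⟩ : ∃ m, m / 2 = θ := ⟨2 * θ, by ring⟩
  have hmu : IsAngleOf (m / 2) (u + u') := ⟨huu'.add_ne_zero, hθ⟩
  have hsm : s ≤ m := by linarith
  have hmt : m ≤ t := by linarith
  have hm : m ∈ Icc a₁ a₂ := ⟨hs.1.trans hsm, hmt.trans ht.2⟩
  obtain ⟨k, hk⟩ := huu'.mediant_left.exists_chord_eq_smul hγ (Icc_subset_uIcc hs)
    (Icc_subset_uIcc hm) hsu hmu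
  obtain ⟨k', hk'⟩ := huu'.mediant_right.exists_chord_eq_smul hγ (Icc_subset_uIcc hm)
    (Icc_subset_uIcc ht) hmu htu
  have hsum : k • (u + (u + u')) + k' • (u + u' + u') = (κ / 3 ^ n) • (u + u') := by
    rw [← hk, ← hk', ← hchord, add_comm, sub_add_sub_cancel]
  obtain ⟨hkκ, hkκ'⟩ := eq_div_three_of_smul_add_smul_eq huu'.areaForm_ne_zero hsum
  rw [div_div, ← pow_succ] at hkκ hkκ'
  have hinner := huu'.inner_nonneg
  obtain ⟨hu, hu'⟩ := huu'.one_div_le_norm_sq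
  have hlevel : ((n + 1 : ℕ) + 2) / r₀ = (n + 2) / r₀ + 1 / r₀ := by push_cast; ring
  refine ⟨m, ⟨u, u + u', huu'.mediant_left, ⟨hs, hm, hsm⟩, hsu, hmu, ?_, hkκ ▸ hk⟩,
    ⟨u + u', u', huu'.mediant_right, ⟨hm, ht, hmt⟩, hmu, htu, ?_, hkκ' ▸ hk'⟩⟩
  all_goals
    rw [hlevel, norm_add_sq_real]
    linarith

theorem mul_sq_le_pi_sq (ha : a₂ < a₁ + Real.pi) (h : IsCell c₀ r₀ hr₀ C₁ C₂ a₁ a₂ γ κ n s t) :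
    (n + 1) * (t - s) ^ 2 ≤ Real.pi ^ 2 := by
  obtain ⟨u, u', huu', ⟨hs, ht, hst⟩, hsu, htu, hnorm, -⟩ := h
  have hsin : (t - s) / Real.pi ≤ Real.sin (t / 2 - s / 2) := by
    have jordan := Real.mul_le_sin (x := t / 2 - s / 2) (by linarith) (by linarith [hs.1, ht.2])
    have hscale : 2 / Real.pi * (t / 2 - s / 2) = (t - s) / Real.pi := by ring
    rwa [hscale] at jordan
  have hsq : (n + 1) * ((t - s) / Real.pi) ^ 2 ≤ 1 := calc
    (n + 1) * ((t - s) / Real.pi) ^ 2 ≤ (n + 1) * Real.sin (t / 2 - s / 2) ^ 2 := by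
      have := div_nonneg (sub_nonneg.2 hst) Real.pi_pos.le
      gcongr
    _ ≤ 1 := huu'.mul_sin_sq_le_one hsu htu (by rwa [add_assoc, one_add_one_eq_two])
  rwa [div_pow, ← mul_div_assoc, div_le_one (by positivity)] at hsq

theorem isSubdivision (hγ : IsApollonianCurve c₀ r₀ hr₀ C₁ C₂ a₁ a₂ γ) (ha : a₂ < a₁ + Real.pi)
    (h : IsCell c₀ r₀ hr₀ C₁ C₂ a₁ a₂ γ κ 0 a₁ a₂) :
    IsSubdivision a₁ a₂ (IsCell c₀ r₀ hr₀ C₁ C₂ a₁ a₂ γ κ) where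
  root := h
  bounds := fun ⟨_, _, _, ⟨hs, ht, hst⟩, _⟩ => ⟨hs.1, hst, ht.2⟩
  split := split hγ ha
  mesh δ hδ := by
    obtain ⟨N, hN⟩ := exists_nat_gt (Real.pi ^ 2 / δ ^ 2)
    filter_upwards [eventually_ge_atTop N] with n hn s t hst
    by_contra! hle
    have hNn : (N : ℝ) ≤ n := Nat.cast_le.2 hn
    have hlt : Real.pi ^ 2 < (n + 1) * δ ^ 2 := by
      rw [div_lt_iff₀ (pow_pos hδ 2)] at hN
      exact hN.trans_le (by gcongr; linarith)
    have hge : (n + 1) * δ ^ 2 ≤ (n + 1) * (t - s) ^ 2 := by gcongr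
    linarith [mul_sq_le_pi_sq ha hst]

theorem sub_mem_sector (ha : a₂ < a₁ + Real.pi)
    (h : IsCell c₀ r₀ hr₀ C₁ C₂ a₁ a₂ γ κ n s t) :
    γ t - γ s ∈ sector (s / 2 + arg κ) (t / 2 + arg κ) := by
  obtain ⟨u, u', -, ⟨hs, ht, hst⟩, hsu, htu, -, hchord⟩ := h
  have hpow : (0 : ℝ) < (3 ^ n)⁻¹ := by positivity
  have harg : arg (κ / 3 ^ n : ℝ) = arg κ := by
    rw [div_eq_inv_mul, ofReal_mul, arg_real_mul _ hpow]
  rw [hchord, real_smul, ← harg]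
  exact mul_mem_sector _ (add_mem_sector (by linarith) (by linarith [hs.1, ht.2, Real.pi_pos])
    (hsu.mem_sector ⟨le_rfl, by linarith⟩) (htu.mem_sector ⟨by linarith, le_rfl⟩))

theorem apply_ne (hκ : κ ≠ 0) (h : IsCell c₀ r₀ hr₀ C₁ C₂ a₁ a₂ γ κ n s t) :
    γ s ≠ γ t := by
  obtain ⟨u, u', huu', -, -, -, -, hchord⟩ := h
  rw [ne_comm, ← sub_ne_zero, hchord]
  exact smul_ne_zero (div_ne_zero hκ (pow_ne_zero n three_ne_zero)) huu'.add_ne_zero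

end IsCell

theorem GenCircle.Family.symm {C₀ C : GenCircle} (h : Family C₀ C₁ C₂ C) :
    Family C₀ C₂ C₁ C := by
  induction h with
  | left => exact .right
  | right => exact .left
  | succ C C' S _ _ ht hS ihC ihC' => exact .succ C C' S ihC ihC' ht hS

namespace IsApollonianCurve

theorem symm (h : IsApollonianCurve c₀ r₀ hr₀ C₁ C₂ a₁ a₂ γ) :
    IsApollonianCurve c₀ r₀ hr₀ C₂ C₁ a₂ a₁ γ where
  continuousOn := uIcc_comm a₁ a₂ ▸ h.continuousOn
  sub_mem C C' S hC hC' := uIcc_comm a₁ a₂ ▸ h.sub_mem C C' S hC.symm hC'.symm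

theorem exists_chordsInSectors_of_le (hγ : IsApollonianCurve c₀ r₀ hr₀ C₁ C₂ a₁ a₂ γ)
    (hle : a₁ ≤ a₂) (h₁ : (circle c₀ r₀ hr₀).ExtTangent C₁)
    (h₂ : (circle c₀ r₀ hr₀).ExtTangent C₂) (h₁₂ : C₁.ExtTangent C₂)
    (ha₁ : IsAngleOf a₁ (C₁.vec c₀)) (ha₂ : IsAngleOf a₂ (C₂.vec c₀)) (ha : |a₁ - a₂| < Real.pi)
    (hne : ∃ t ∈ Icc a₁ a₂, ∃ t' ∈ Icc a₁ a₂, γ t ≠ γ t') :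
    ∃ c, Real.sin c = 0 ∧ InjOn γ (Icc a₁ a₂) ∧
      ChordsInSectors γ (Icc a₁ a₂) (fun t => t / 2 + c) := by
  have hlt : a₂ < a₁ + Real.pi := by linarith [(abs_lt.1 ha).1]
  have hleft := left_mem_Icc.2 hle
  have hright := right_mem_Icc.2 hle
  obtain ⟨u, u', huu', hau, hau'⟩ := exists_isTangentPair h₁ h₂ h₁₂ ha₁ ha₂ ha
  obtain ⟨κ, hκ⟩ := huu'.exists_chord_eq_smul hγ left_mem_uIcc right_mem_uIcc hau hau'
  have root : IsCell c₀ r₀ hr₀ C₁ C₂ a₁ a₂ γ κ 0 a₁ a₂ := by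
    obtain ⟨hu, hu'⟩ := huu'.one_div_le_norm_sq
    refine ⟨u, u', huu', ⟨hleft, hright, hle⟩, hau, hau', ?_, by rw [hκ, pow_zero, div_one]⟩
    rw [Nat.cast_zero, zero_add, div_eq_mul_one_div]
    linarith
  have hP := IsCell.isSubdivision hγ hlt root
  have hφπ : a₂ / 2 + arg κ < a₁ / 2 + arg κ + Real.pi := by linarith [Real.pi_pos]
  have chords : ChordsInSectors γ (Icc a₁ a₂) (fun t => t / 2 + arg κ) :=
    hP.chordsInSectors (uIcc_of_le hle ▸ hγ.continuousOn) (by fun_prop)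
      (fun s _ t _ hst => by linarith) hφπ (IsCell.sub_mem_sector hlt)
  have endpoints_ne : γ a₁ ≠ γ a₂ := fun h => by
    have constant : ∀ t ∈ Icc a₁ a₂, γ t = γ a₁ := fun t ht =>
      chords.eq_of_eq_of_mem_Icc hleft ht hright ht hφπ h
    obtain ⟨t, ht, t', ht', htt'⟩ := hne
    exact htt' ((constant t ht).trans (constant t' ht').symm)
  have hκ0 : κ ≠ 0 := fun h0 => endpoints_ne (by
    rw [h0, zero_smul, sub_eq_zero] at hκ
    exact hκ.symm)
  exact ⟨arg κ, by rw [sin_arg, ofReal_im, zero_div],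
    hP.injOn_of_chordsInSectors chords hφπ (IsCell.apply_ne hκ0), chords⟩

theorem exists_chordsInSectors (hγ : IsApollonianCurve c₀ r₀ hr₀ C₁ C₂ a₁ a₂ γ)
    (h₁ : (circle c₀ r₀ hr₀).ExtTangent C₁) (h₂ : (circle c₀ r₀ hr₀).ExtTangent C₂)
    (h₁₂ : C₁.ExtTangent C₂) (ha₁ : IsAngleOf a₁ (C₁.vec c₀)) (ha₂ : IsAngleOf a₂ (C₂.vec c₀))
    (ha : |a₁ - a₂| < Real.pi) (hne : ∃ t ∈ uIcc a₁ a₂, ∃ t' ∈ uIcc a₁ a₂, γ t ≠ γ t') :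
    ∃ c, Real.sin c = 0 ∧ InjOn γ (uIcc a₁ a₂) ∧
      ChordsInSectors γ (uIcc a₁ a₂) (fun t => t / 2 + c) := by
  rcases le_total a₁ a₂ with hle | hle
  · rw [uIcc_of_le hle] at hne ⊢
    exact hγ.exists_chordsInSectors_of_le hle h₁ h₂ h₁₂ ha₁ ha₂ ha hne
  · rw [uIcc_of_ge hle] at hne ⊢
    exact hγ.symm.exists_chordsInSectors_of_le hle h₂ h₁ h₁₂.symm ha₂ ha₁ (abs_sub_comm a₁ a₂ ▸ ha)
      hne

end IsApollonianCurve

end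

theorem theorem5p3 (c₀ : ℂ) (r₀ : ℝ) (hr₀ : 0 < r₀) (C₁ C₂ : GenCircle)
    (h₀₁ : (GenCircle.circle c₀ r₀ hr₀).ExtTangent C₁)
    (h₀₂ : (GenCircle.circle c₀ r₀ hr₀).ExtTangent C₂)
    (h₁₂ : C₁.ExtTangent C₂)
    (a₁ a₂ : ℝ) (ha₁ : IsAngleOf a₁ (C₁.vec c₀)) (ha₂ : IsAngleOf a₂ (C₂.vec c₀))
    (ha : |a₁ - a₂| < Real.pi)
    (γ : ℝ → ℂ) (hγ : IsApollonianCurve c₀ r₀ hr₀ C₁ C₂ a₁ a₂ γ)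
    (hne : ∃ t ∈ Set.uIcc a₁ a₂, ∃ t' ∈ Set.uIcc a₁ a₂, γ t ≠ γ t') :
    (∀ t ∈ Set.uIcc a₁ a₂,
      IsTangentLine (γ '' Set.uIcc a₁ a₂) (γ t) (lineAtAngle (γ t) (t / 2)) ∧
      ∀ L : AffineSubspace ℝ ℂ, IsTangentLine (γ '' Set.uIcc a₁ a₂) (γ t) L →
        L = lineAtAngle (γ t) (t / 2)) ∧
    IsConvexCurve γ (Set.uIcc a₁ a₂) := by
  obtain ⟨c, hc, hinj, hchords⟩ := hγ.exists_chordsInSectors h₀₁ h₀₂ h₁₂ ha₁ ha₂ ha hne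
  have hI : (uIcc a₁ a₂).Nontrivial :=
    have ⟨t, ht, t', ht', htt'⟩ := hne
    ⟨t, ht, t', ht', ne_of_apply_ne γ htt'⟩
  have hφ : ContinuousOn (fun t => t / 2 + c) (uIcc a₁ a₂) := by fun_prop
  refine ⟨fun t ht => ?_, hchords.isConvexCurve isCompact_uIcc isPreconnected_uIcc hI
    hγ.continuousOn hinj hφ fun s hs t ht => ?_⟩
  · have tangent := hchords.isTangentLine isCompact_uIcc isPreconnected_uIcc hI
      hγ.continuousOn hinj hφ ht
    rw [lineAtAngle_eq_of_sin_eq_zero (by rwa [add_sub_cancel_left])] at tangent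
    exact ⟨tangent, fun L hL => hL.eq_of_lineAtAngle tangent⟩
  · have hst : |t - s| ≤ |a₂ - a₁| := abs_sub_le_of_uIcc_subset_uIcc (uIcc_subset_uIcc hs ht)
    rw [abs_sub_comm a₁ a₂] at ha
    linarith [le_abs_self (t - s), abs_nonneg (t - s)]
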